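/- Let $\mathbb F_q$ be a finite field of characteristic $p$, let $\ell_0\neq p$ be a prime, and let $E/\mathbb F_q$ be an elliptic curve. Let $H^1=\operatorname{Hom}_{\mathbb Z_{\ell_0}}(T_{\ell_0}E,\mathbb Z_{\ell_0})$ be the dual of its $\ell_0$-adic Tate module, and let $\gamma_0\in \mathrm{GL}_2(\mathbb Z_{\ell_0})$ be the matrix, in any $\mathbb Z_{\ell_0}$-basis of $H^1$, of the endomorphism induced by the $q$-power Frobenius. Let $f(T)=T^2-aT+q$, with $a\in\mathbb Z$, be its characteristic polynomial, so that $\operatorname{disc}(f)=a^2-4q$. Assume that $p\nmid a$, that $\ell_0^2$ is the exact power of $\ell_0$ dividing $a^2-4q$, and that $E$ admits a full level-$\ell_0$ structure $\alpha$ over $\mathbb F_q$, i.e. an isomorphism $\alpha:(\mathbb Z/\ell_0)^2\to E[\ell_0](\overline{\mathbb F}_q)$ all of whose values are fixed by Frobenius. Write $G=\mathrm{GL}_2$ and $\mathbb A_G=\mathbb A^1\times\mathbb G_m$, let $\pi_n:G(\mathbb Z_{\ell_0})\to G(\mathbb Z/\ell_0^n)$ be the reduction map, and let $\Gamma=\ker\bigl(G(\mathbb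 Z_{\ell_0})\to G(\mathbb Z/\ell_0)\bigr)$. For $\gamma\in G(\mathbb Z_{\ell_0})$ and $d\ge 0$ write $\gamma\sim_d\gamma_0$ if there is $A\in \mathrm{Mat}_2(\mathbb Z_{\ell_0})$ with $\det A\neq 0$, $\operatorname{ord}_{\ell_0}(\det A)\le d$ and $A\gamma=\gamma_0A$; put $$C_{(d,n)}(\gamma_0)=\pi_n\bigl(\{\gamma\in G(\mathbb Z_{\ell_0}):\gamma\sim_d\gamma_0\}\bigr)\subseteq G(\mathbb Z/\ell_0^n).$$ Let $\chi_{\ell_0}=\left(\frac{\cdot}{\ell_0}\right)$ be the quadratic character modulo $\ell_0$ (the Kronecker symbol if $\ell_0=2$: $\chi_2(D)=0$ for $D$ even, $1$ for $D\equiv\pm1$, $-1$ for $D\equiv\pm3\pmod 8$). Then the iterated limit $$\nu_{\ell_0}([E,\lambda,\alpha])=\lim_{d\to\infty}\lim_{n\to\infty}\frac{\#\bigl(C_{(d,n)}(\gamma_0)\cap\pi_n(\Gamma)\bigr)}{\#G(\mathbb Z/\ell_0^n)/\#\mathbb A_G(\mathbb Z/\ell_0^n)}$$ (where $\lambda$ is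 the canonical principal polarization) exists, and $$\nu_{\ell_0}([E,\lambda,\alpha])=\frac1{\ell_0^2}\cdot\frac1{1-\chi_{\ell_0}(\operatorname{disc}(f)/\ell_0^2)/\ell_0}.$$ -/

import Mathlib

open Filter Topology

noncomputable section

namespace EllipticLevel

section Curve

variable {F : Type*} [Field F]

/-- The group of points of an elliptic curve over `F` with coordinates in an algebraic closure
of `F`. -/
def GeomPoint (E : WeierstrassCurve F) : Type _ :=
  (E.baseChange (AlgebraicClosure F)).toAffine.Point

open Classical in
instance (E : WeierstrassCurve F) : AddCommGroup (GeomPoint E) :=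
  inferInstanceAs (AddCommGroup (E.baseChange (AlgebraicClosure F)).toAffine.Point)

open Classical in
/-- The Frobenius endomorphism `(x, y) ↦ (x ^ q, y ^ q)`, where `q` is the number of elements
of `F`. -/
def frobenius [Fintype F] (E : WeierstrassCurve F) : GeomPoint E →+ GeomPoint E :=
  WeierstrassCurve.Affine.Point.map (W' := E)
    (FiniteField.frobeniusAlgHom F (AlgebraicClosure F))

/-- The geometric `m`-torsion subgroup. -/
def torsion (E : WeierstrassCurve F) (m : ℕ) : AddSubgroup (GeomPoint E) :=
  (nsmulAddMonoidHom m : GeomPoint E →+ GeomPoint E).ker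

/-- A full (principal) level `ℓ` structure over `F`: an isomorphism of `(ℤ/ℓ)²` with the
geometric `ℓ`-torsion which is rational over `F`, that is, all of whose values are fixed by
Frobenius. -/
structure FullLevelStructure [Fintype F] (E : WeierstrassCurve F) (ℓ : ℕ) where
  toEquiv : (Fin 2 → ZMod ℓ) ≃+ torsion E ℓ
  rational : ∀ v, frobenius E (toEquiv v) = toEquiv v

variable (E : WeierstrassCurve F) (ℓ : ℕ)

/-- The `ℓ`-adic Tate module: sequences of points `P n` with `P 0 = 0` and
`ℓ • P (n + 1) = P n`. -/
def tateSubgroup : AddSubgroup (ℕ → GeomPoint E) where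
  carrier := {P | P 0 = 0 ∧ ∀ n, ℓ • P (n + 1) = P n}
  zero_mem' := by simp
  add_mem' := by
    rintro P Q ⟨hP, hP'⟩ ⟨hQ, hQ'⟩
    exact ⟨by simp [hP, hQ], fun n => by simp [smul_add, hP', hQ']⟩
  neg_mem' := by
    rintro P ⟨hP, hP'⟩
    exact ⟨by simp [hP], fun n => by simp [hP']⟩

/-- The `ℓ`-adic Tate module. -/
abbrev TateModule : Type _ := tateSubgroup E ℓ

variable {E ℓ}

theorem TateModule.pow_smul (P : TateModule E ℓ) (n : ℕ) : ℓ ^ n • P.1 n = 0 := by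
  induction n with
  | zero => simpa using P.2.1
  | succ n ih => rw [pow_succ, mul_smul, P.2.2 n, ih]

theorem TateModule.smul_eq (P : TateModule E ℓ) (n : ℕ) {a b : ℕ}
    (h : (a : ZMod (ℓ ^ n)) = b) : a • P.1 n = b • P.1 n := by
  rw [ZMod.natCast_eq_natCast_iff] at h
  have hd : addOrderOf (P.1 n) ∣ ℓ ^ n := addOrderOf_dvd_of_nsmul_eq_zero (P.pow_smul n)
  exact nsmul_eq_nsmul_iff_modEq.2 (h.of_dvd hd)

theorem TateModule.add_apply (P Q : TateModule E ℓ) (n : ℕ) : (P + Q).1 n = P.1 n + Q.1 n := rfl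

theorem TateModule.zero_apply (n : ℕ) : (0 : TateModule E ℓ).1 n = 0 := rfl

variable [Fact ℓ.Prime]

/-- An `ℓ`-adic integer acts on the `n`-th term through its residue modulo `ℓ ^ n`. -/
instance : SMul ℤ_[ℓ] (TateModule E ℓ) where
  smul x P := ⟨fun n => (PadicInt.toZModPow n x).val • P.1 n, by
    have hz : ∀ n, NeZero (ℓ ^ n) := fun n => ⟨pow_ne_zero _ (Fact.out : ℓ.Prime).ne_zero⟩
    refine ⟨by simp [P.2.1], fun n => ?_⟩
    rw [smul_comm, P.2.2 n]
    apply P.smul_eq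
    have := PadicInt.cast_toZModPow n (n + 1) (Nat.le_succ n) x
    rw [ZMod.natCast_val, ZMod.natCast_val, this, ZMod.cast_id]⟩

theorem TateModule.smul_apply (x : ℤ_[ℓ]) (P : TateModule E ℓ) (n : ℕ) :
    (x • P).1 n = (PadicInt.toZModPow n x).val • P.1 n := rfl

instance : Module ℤ_[ℓ] (TateModule E ℓ) where
  one_smul P := by
    refine Subtype.ext (funext fun n => ?_)
    have : NeZero (ℓ ^ n) := ⟨pow_ne_zero _ (Fact.out : ℓ.Prime).ne_zero⟩
    rw [TateModule.smul_apply]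
    conv_rhs => rw [← one_nsmul (P.1 n)]
    apply P.smul_eq
    simp
  mul_smul x y P := by
    refine Subtype.ext (funext fun n => ?_)
    have : NeZero (ℓ ^ n) := ⟨pow_ne_zero _ (Fact.out : ℓ.Prime).ne_zero⟩
    simp only [TateModule.smul_apply]
    rw [← mul_smul]
    apply P.smul_eq
    simp
  smul_zero x := by
    refine Subtype.ext (funext fun n => ?_)
    simp [TateModule.smul_apply, TateModule.zero_apply]
  smul_add x P Q := by
    refine Subtype.ext (funext fun n => ?_)
    simp [TateModule.smul_apply, TateModule.add_apply]
  add_smul x y P := by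
    refine Subtype.ext (funext fun n => ?_)
    have : NeZero (ℓ ^ n) := ⟨pow_ne_zero _ (Fact.out : ℓ.Prime).ne_zero⟩
    simp only [TateModule.smul_apply, TateModule.add_apply]
    rw [← add_smul]
    apply P.smul_eq
    simp
  zero_smul P := by
    refine Subtype.ext (funext fun n => ?_)
    simp [TateModule.smul_apply, TateModule.zero_apply]

variable [Fintype F]

variable (E ℓ) in
/-- Frobenius on the Tate module. -/
def frobeniusTate : TateModule E ℓ →ₗ[ℤ_[ℓ]] TateModule E ℓ where
  toFun P := ⟨fun n => frobenius E (P.1 n), by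
    refine ⟨?_, fun n => ?_⟩
    · change frobenius E (P.1 0) = 0
      rw [P.2.1, map_zero]
    · change ℓ • frobenius E (P.1 (n + 1)) = frobenius E (P.1 n)
      rw [← map_nsmul, P.2.2 n]⟩
  map_add' P Q := Subtype.ext (funext fun n => by
    exact map_add (frobenius E) (P.1 n) (Q.1 n))
  map_smul' x P := Subtype.ext (funext fun n => by
    exact map_nsmul (frobenius E) _ (P.1 n))

variable (E ℓ) in
/-- `H¹(E, ℤ_ℓ)`, the dual of the Tate module. -/
abbrev H1 : Type _ := Module.Dual ℤ_[ℓ] (TateModule E ℓ)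

variable (E ℓ) in
/-- Frobenius on `H¹(E, ℤ_ℓ)`, by functoriality. -/
def frobeniusH1 : H1 E ℓ →ₗ[ℤ_[ℓ]] H1 E ℓ := (frobeniusTate E ℓ).dualMap

/-- The matrix of Frobenius on `H¹(E, ℤ_ℓ)` in a basis. -/
def frobeniusMatrix (b : Module.Basis (Fin 2) ℤ_[ℓ] (H1 E ℓ)) : Matrix (Fin 2) (Fin 2) ℤ_[ℓ] :=
  LinearMap.toMatrix b b (frobeniusH1 E ℓ)

end Curve

section Ratio

variable (ℓ : ℕ) [Fact ℓ.Prime]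

/-- Reduction `GL₂(ℤ_ℓ) → GL₂(ℤ/ℓⁿ)`. -/
def reduction (n : ℕ) : GL (Fin 2) ℤ_[ℓ] →* GL (Fin 2) (ZMod (ℓ ^ n)) :=
  Matrix.GeneralLinearGroup.map (PadicInt.toZModPow n)

/-- The principal congruence subgroup `ker (GL₂(ℤ_ℓ) → GL₂(ℤ/ℓ))`. -/
def principalSubgroup : Subgroup (GL (Fin 2) ℤ_[ℓ]) :=
  (Matrix.GeneralLinearGroup.map (n := Fin 2) (PadicInt.toZMod (p := ℓ))).ker

/-- `2 × 2` matrices over `ℤ_ℓ`, invertible over `ℚ_ℓ`, whose determinant has valuation at most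
`d`. -/
def boundedSimilitudes (d : ℕ) : Set (Matrix (Fin 2) (Fin 2) ℤ_[ℓ]) :=
  {A | A.det ≠ 0 ∧ A.det.valuation ≤ d}

variable {ℓ}

/-- `γ` and `γ₀` are conjugate through an integral matrix whose determinant has valuation at
most `d`. -/
def BoundedConj (d : ℕ) (γ γ₀ : Matrix (Fin 2) (Fin 2) ℤ_[ℓ]) : Prop :=
  ∃ A ∈ boundedSimilitudes ℓ d, A * γ = γ₀ * A

/-- `C_{(d,n)}(γ₀)`: the elements of `GL₂(ℤ/ℓⁿ)` that are reductions of elements of `GL₂(ℤ_ℓ)`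
conjugate to `γ₀` in the sense of `BoundedConj d`. -/
def conjClassTrunc (γ₀ : Matrix (Fin 2) (Fin 2) ℤ_[ℓ]) (d n : ℕ) :
    Set (GL (Fin 2) (ZMod (ℓ ^ n))) :=
  reduction ℓ n '' {γ | BoundedConj d γ.val γ₀}

/-- The ratio of `#(C_{(d,n)}(γ₀) ∩ π_n(Γ))` to `#G(ℤ/ℓⁿ) / #𝔸_G(ℤ/ℓⁿ)`, for `G = GL₂` and
its Steinberg quotient `𝔸_G = 𝔸¹ × 𝔾_m`. -/
def levelRatio (Γ : Subgroup (GL (Fin 2) ℤ_[ℓ])) (γ₀ : Matrix (Fin 2) (Fin 2) ℤ_[ℓ])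
    (d n : ℕ) : ℝ :=
  ((conjClassTrunc γ₀ d n ∩ reduction ℓ n '' (Γ : Set (GL (Fin 2) ℤ_[ℓ]))).ncard : ℝ) /
    ((Nat.card (GL (Fin 2) (ZMod (ℓ ^ n))) : ℝ) /
      (Nat.card (ZMod (ℓ ^ n) × (ZMod (ℓ ^ n))ˣ) : ℝ))

/-- The local factor `lim_{d → ∞} lim_{n → ∞}` of the ratios above exists and equals `v`. -/
def IsLocalFactor (Γ : Subgroup (GL (Fin 2) ℤ_[ℓ])) (γ₀ : Matrix (Fin 2) (Fin 2) ℤ_[ℓ])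
    (v : ℝ) : Prop :=
  ∃ L : ℕ → ℝ, (∀ d, Tendsto (fun n => levelRatio Γ γ₀ d n) atTop (𝓝 (L d))) ∧
    Tendsto L atTop (𝓝 v)

end Ratio

/-- The Kronecker symbol `(D / ℓ)` at a prime `ℓ`: the Legendre symbol for odd `ℓ`; for `ℓ = 2`,
it is `0` for even `D`, `1` for `D ≡ ±1` and `-1` for `D ≡ ±3` modulo `8`. -/
def kroneckerChar (ℓ : ℕ) [Fact ℓ.Prime] (D : ℤ) : ℤ :=
  if ℓ = 2 then ZMod.χ₈ (D : ZMod 8) else legendreSym ℓ D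

end EllipticLevel

end

/-!
Write `ℓ` for `ℓ₀` and `γ₀` for the matrix of Frobenius. The level structure says that Frobenius
fixes the `ℓ`-torsion, so `Frob - 1` is divisible by `ℓ` on the Tate module
(`frobeniusSubOneDiv`) and `γ₀ = 1 + ℓ N` for an integral matrix `N`
(`exists_frobeniusMatrix_eq`). The characteristic polynomial of `N` has discriminant
`D = (a² - 4q) / ℓ²`, which is prime to `ℓ`: the order `ℤ_ℓ[N]` is maximal and unramified.

Since `D` is a unit, every integral matrix with the characteristic polynomial of `N` is
`GL₂(ℤ_ℓ)`-conjugate to the companion matrix `C` of that polynomial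
(`exists_mul_eq_mul_companion`). Hence allowing denominators in the conjugation makes no
difference inside `Γ`: for all `d` and all `n ≥ 1`, the set `C_{(d,n)}(γ₀) ∩ π_n(Γ)` is the
conjugacy class of `1 + ℓ C` in `GL₂(ℤ/ℓⁿ)` (`conjClassTrunc_inter_eq_conjugatesOf`). By the
orbit-stabilizer theorem the ratio is `#𝔸_G(ℤ/ℓⁿ)` divided by the order of the centralizer of
`1 + ℓ C`, and `#GL₂(ℤ/ℓⁿ)` cancels.

For `n ≥ 2` the order of this centralizer is `ℓ²ⁿ` times the number of units of the quadratic
algebra `𝔽_ℓ[C]` (`card_centralizer_mul_sq`). That algebra is `𝔽_ℓ × 𝔽_ℓ` or `𝔽_{ℓ²}`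
according to `χ(D) = ±1`, and in both cases it has `(ℓ - 1) (ℓ - χ(D))` units
(`card_normForm_ne_zero`, `card_roots_eq_one_add_kroneckerChar`). As
`#𝔸_G(ℤ/ℓⁿ) = ℓ²ⁿ⁻¹ (ℓ - 1)`, the ratio is `1 / (ℓ (ℓ - χ(D)))`, independently of `d` and `n ≥ 2`.
-/

noncomputable section

namespace EllipticLevel

/-! ### Frobenius on the Tate module in the presence of a level structure -/

section Frobenius

variable {F : Type*} [Field F] [Fintype F] {E : WeierstrassCurve F} {ℓ : ℕ}

theorem frobenius_eq_of_torsion (α : FullLevelStructure E ℓ) {P : GeomPoint E}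
    (hP : ℓ • P = 0) : frobenius E P = P := by
  obtain ⟨v, hv⟩ := α.toEquiv.surjective ⟨P, hP⟩
  simpa [hv] using α.rational v

theorem frobenius_shift_sub_shift_mem (α : FullLevelStructure E ℓ) (P : TateModule E ℓ) :
    (fun n => frobenius E (P.1 (n + 1)) - P.1 (n + 1)) ∈ tateSubgroup E ℓ := by
  refine ⟨?_, fun n => ?_⟩
  · have h := P.pow_smul 1
    rw [pow_one] at h
    exact sub_eq_zero.2 (frobenius_eq_of_torsion α h)
  · rw [smul_sub, ← map_nsmul, P.2.2 (n + 1)]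

variable [Fact ℓ.Prime]

/-- The quotient of `Frob - 1` by `ℓ` on the Tate module. Multiplication by `ℓ` shifts a sequence
of points by one place, so the division is the shift in the other direction; the shifted sequence
starts at `0` because Frobenius fixes the `ℓ`-torsion. -/
def frobeniusSubOneDiv (α : FullLevelStructure E ℓ) :
    TateModule E ℓ →ₗ[ℤ_[ℓ]] TateModule E ℓ where
  toFun P := ⟨fun n => frobenius E (P.1 (n + 1)) - P.1 (n + 1),
    frobenius_shift_sub_shift_mem α P⟩
  map_add' P Q := Subtype.ext (funext fun n => by
    simp only [TateModule.add_apply, map_add]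
    abel)
  map_smul' x P := by
    refine Subtype.ext (funext fun n => ?_)
    have : NeZero (ℓ ^ n) := ⟨pow_ne_zero _ (Fact.out : ℓ.Prime).ne_zero⟩
    have : NeZero (ℓ ^ (n + 1)) := ⟨pow_ne_zero _ (Fact.out : ℓ.Prime).ne_zero⟩
    simp only [TateModule.smul_apply, map_nsmul, ← smul_sub, RingHom.id_apply]
    refine TateModule.smul_eq (ℓ := ℓ) ⟨_, frobenius_shift_sub_shift_mem α P⟩ n ?_
    rw [ZMod.natCast_val, ZMod.natCast_val, PadicInt.cast_toZModPow n (n + 1) n.le_succ x,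
      ZMod.cast_id]

theorem frobeniusTate_eq (α : FullLevelStructure E ℓ) :
    frobeniusTate E ℓ = LinearMap.id + (ℓ : ℤ_[ℓ]) • frobeniusSubOneDiv α := by
  refine LinearMap.ext fun P => Subtype.ext (funext fun n => ?_)
  rw [LinearMap.add_apply, LinearMap.smul_apply, Nat.cast_smul_eq_nsmul, TateModule.add_apply]
  change frobenius E (P.1 n) = P.1 n + ℓ • (frobenius E (P.1 (n + 1)) - P.1 (n + 1))
  rw [smul_sub, ← map_nsmul, P.2.2 n]
  abel

/-- A full level-`ℓ` structure makes the matrix of Frobenius congruent to `1` modulo `ℓ`. -/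
theorem exists_frobeniusMatrix_eq (α : FullLevelStructure E ℓ)
    (b : Module.Basis (Fin 2) ℤ_[ℓ] (H1 E ℓ)) :
    ∃ N : Matrix (Fin 2) (Fin 2) ℤ_[ℓ], frobeniusMatrix b = 1 + (ℓ : ℤ_[ℓ]) • N := by
  refine ⟨LinearMap.toMatrix b b (frobeniusSubOneDiv α).dualMap, ?_⟩
  have h : frobeniusH1 E ℓ = LinearMap.id + (ℓ : ℤ_[ℓ]) • (frobeniusSubOneDiv α).dualMap := by
    refine LinearMap.ext fun φ => LinearMap.ext fun P => ?_
    simp [frobeniusH1, frobeniusTate_eq α]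
  rw [frobeniusMatrix, h, map_add, map_smul, LinearMap.toMatrix_id]

end Frobenius

/-! ### Conjugation to companion matrices -/

section Companion
variable {R : Type*} [CommRing R]

/-- The companion matrix of `X ^ 2 - t * X + m`. -/
def companion (t m : R) : Matrix (Fin 2) (Fin 2) R := !![0, -m; 1, t]

/-- Over a local ring, a `2 × 2` matrix whose characteristic polynomial has unit discriminant is
conjugate to the companion matrix. It is not scalar modulo the maximal ideal, so one of the vectors
`(1, 0)`, `(0, 1)`, `(1, 1)` is cyclic for it. -/
theorem exists_mul_eq_mul_companion [IsLocalRing R] (M : Matrix (Fin 2) (Fin 2) R)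
    (hM : IsUnit (M.trace ^ 2 - 4 * M.det)) :
    ∃ P : GL (Fin 2) R, M * P.val = P.val * companion M.trace M.det := by
  -- the condition is that `(v, w)` and its image under `M` form a basis
  have key : ∀ v w : R, IsUnit (v * (M 1 0 * v + M 1 1 * w) - w * (M 0 0 * v + M 0 1 * w)) →
      ∃ P : GL (Fin 2) R, M * P.val = P.val * companion M.trace M.det := by
    intro v w h
    refine ⟨Matrix.GeneralLinearGroup.mk'' !![v, M 0 0 * v + M 0 1 * w; w, M 1 0 * v + M 1 1 * w]
      ?_, ?_⟩
    · convert h using 1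
      rw [Matrix.det_fin_two_of]
      ring
    · change M * !![v, M 0 0 * v + M 0 1 * w; w, M 1 0 * v + M 1 1 * w] =
        !![v, M 0 0 * v + M 0 1 * w; w, M 1 0 * v + M 1 1 * w] * _
      ext i j
      fin_cases i <;> fin_cases j <;>
        simp [companion, Matrix.mul_apply, Fin.sum_univ_two, Matrix.trace_fin_two,
          Matrix.det_fin_two] <;> ring
  by_cases h₁ : IsUnit (M 1 0)
  · exact key 1 0 (by simpa using h₁)
  by_cases h₂ : IsUnit (M 0 1)
  · exact key 0 1 (by simpa using h₂)
  -- otherwise the discriminant is `(M 1 1 - M 0 0) ^ 2` modulo the maximal ideal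
  refine key 1 1 ?_
  rw [← mem_nonunits_iff, ← IsLocalRing.mem_maximalIdeal] at h₁ h₂
  by_contra h₃
  rw [← mem_nonunits_iff, ← IsLocalRing.mem_maximalIdeal] at h₃
  refine (IsLocalRing.mem_maximalIdeal _).1 ?_ hM
  have h₄ : M 1 1 - M 0 0 ∈ IsLocalRing.maximalIdeal R := by
    convert Ideal.add_mem _ (Ideal.sub_mem _ h₃ h₁) h₂ using 1
    ring
  convert Ideal.add_mem _ (Ideal.mul_mem_left _ (M 1 1 - M 0 0) h₄)
    (Ideal.mul_mem_left _ (4 * M 0 1) h₁) using 1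
  rw [Matrix.trace_fin_two, Matrix.det_fin_two]
  ring

theorem det_one_add_smul (x : R) (M : Matrix (Fin 2) (Fin 2) R) :
    (1 + x • M).det = 1 + x * M.trace + x ^ 2 * M.det := by
  simp [Matrix.det_fin_two, Matrix.trace_fin_two]
  ring

theorem trace_one_add_smul (x : R) (M : Matrix (Fin 2) (Fin 2) R) :
    (1 + x • M).trace = 2 + x * M.trace := by
  simp [Matrix.trace_add]

theorem trace_companion (t m : R) : (companion t m).trace = t := by
  simp [companion, Matrix.trace_fin_two]

theorem det_companion (t m : R) : (companion t m).det = m := by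
  simp [companion, Matrix.det_fin_two]

theorem trace_eq_and_det_eq_of_mul_eq_mul [IsDomain R] {A M N : Matrix (Fin 2) (Fin 2) R}
    (hA : A.det ≠ 0) (h : A * M = N * A) : M.trace = N.trace ∧ M.det = N.det := by
  constructor
  · apply mul_left_cancel₀ hA
    have h1 : (A.adjugate * (A * M)).trace = A.det * M.trace := by
      rw [← mul_assoc, Matrix.adjugate_mul]; simp
    have h2 : (A.adjugate * (N * A)).trace = A.det * N.trace := by
      rw [Matrix.trace_mul_comm, mul_assoc, Matrix.mul_adjugate]; simp
    rw [← h1, h, h2]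
  · apply mul_left_cancel₀ hA
    have := congrArg Matrix.det h
    rw [Matrix.det_mul, Matrix.det_mul] at this
    rw [this, mul_comm]

end Companion

/-! ### Roots, norm forms and centralizers -/

section Count

theorem card_preimage_mul_card {A B : Type*} [AddGroup A] [AddGroup B] [Finite A]
    (f : A →+ B) (hf : Function.Surjective f) (S : Set B) :
    Nat.card (f ⁻¹' S) * Nat.card B = Nat.card A * Nat.card S := by
  let e : A ⧸ f.ker ≃+ B := QuotientAddGroup.quotientKerEquivOfSurjective f hf
  have h1 : Nat.card (f ⁻¹' S) = Nat.card f.ker * Nat.card S := by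
    have hS : f ⁻¹' S = QuotientAddGroup.mk (s := f.ker) ⁻¹' (e ⁻¹' S) := rfl
    rw [hS, Nat.card_congr (QuotientAddGroup.preimageMkEquivAddSubgroupProdSet _ _),
      Nat.card_prod, Nat.card_preimage_of_injective e.injective (by simp [e.surjective.range_eq])]
  rw [h1, ← Nat.card_congr e.toEquiv, mul_right_comm, mul_comm (Nat.card f.ker),
    ← AddSubgroup.card_eq_card_quotient_mul_card_addSubgroup]

/-- The number of units of the algebra `K[X] / (X ^ 2 + t * X + m)`, in terms of the number of roots
of the polynomial. The form is the norm of the element `w.1 - w.2 * X`. -/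
theorem card_normForm_ne_zero {K : Type*} [Field K] [Fintype K] [DecidableEq K] (t m : K) :
    (Nat.card {w : K × K | w.1 ^ 2 + t * w.1 * w.2 + m * w.2 ^ 2 ≠ 0} : ℤ) =
      (Fintype.card K - 1) *
        (Fintype.card K + 1 - (Finset.univ.filter fun x : K => x ^ 2 + t * x + m = 0).card) := by
  set N := (Finset.univ.filter fun x : K => x ^ 2 + t * x + m = 0).card with hN
  have hsum : (Nat.card {w : K × K | w.1 ^ 2 + t * w.1 * w.2 + m * w.2 ^ 2 ≠ 0} : ℤ) =
      ∑ r : K, ∑ x : K, if x ^ 2 + t * x * r + m * r ^ 2 ≠ 0 then (1 : ℤ) else 0 := by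
    rw [← Fintype.sum_prod_type_right', Nat.card_eq_fintype_card, Fintype.card_subtype,
      Finset.sum_boole]
    simp only [Set.mem_ofPred_eq]
  have hroots : ∑ x : K, (if x ^ 2 + t * x + m ≠ 0 then (1 : ℤ) else 0) = Fintype.card K - N := by
    rw [Finset.sum_boole, eq_sub_iff_add_eq', hN, ← Finset.card_univ]
    exact_mod_cast Finset.card_filter_add_card_filter_not _
  have hne : ∀ r : K, r ≠ 0 →
      ∑ x : K, (if x ^ 2 + t * x * r + m * r ^ 2 ≠ 0 then (1 : ℤ) else 0) =
        Fintype.card K - N := by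
    intro r hr
    rw [← hroots, ← Equiv.sum_comp (Equiv.mulRight₀ r hr)]
    refine Finset.sum_congr rfl fun x _ => ?_
    have : (Equiv.mulRight₀ r hr x) ^ 2 + t * (Equiv.mulRight₀ r hr x) * r + m * r ^ 2 =
        (x ^ 2 + t * x + m) * r ^ 2 := by
      simp only [Equiv.mulRight₀_apply]
      ring
    rw [this]
    simp [hr]
  have hzero : ∑ x : K, (if x ^ 2 + t * x * 0 + m * 0 ^ 2 ≠ 0 then (1 : ℤ) else 0) =
      Fintype.card K - 1 := by
    have : (Finset.univ.filter fun x : K => x ≠ 0).card + 1 = Fintype.card K := by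
      rw [Finset.filter_ne', Finset.card_erase_add_one (Finset.mem_univ _), Finset.card_univ]
    simp only [mul_zero, add_zero, ne_eq, OfNat.ofNat_ne_zero, not_false_eq_true, zero_pow,
      pow_eq_zero_iff, Finset.sum_boole]
    rw [← this]
    simp
  rw [hsum, Fintype.sum_eq_add_sum_compl (0 : K), hzero,
    Finset.sum_congr rfl (g := fun _ => (Fintype.card K - N : ℤ))
      fun r hr => hne r (by simpa using hr),
    Finset.sum_const, Finset.card_compl, Finset.card_singleton, nsmul_eq_mul,
    Nat.cast_sub Fintype.card_pos]
  push_cast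
  ring

/-- The case `ℓ = 2` of the root count: since `χ₈` only depends on the discriminant modulo `8`, it
is a finite check. -/
theorem card_roots_two : ∀ t m D : ZMod 8, t ^ 2 - 4 * m = D →
    ZMod.castHom (show 2 ∣ 8 by norm_num) (ZMod 2) D ≠ 0 →
    ((Finset.univ.filter fun x : ZMod 2 =>
      x ^ 2 + ZMod.castHom (show 2 ∣ 8 by norm_num) (ZMod 2) t * x +
        ZMod.castHom (show 2 ∣ 8 by norm_num) (ZMod 2) m = 0).card : ℤ) = 1 + ZMod.χ₈ D := by
  decide

variable {ℓ : ℕ} [Fact ℓ.Prime]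

/-- The residue map of `ℤ_ℓ` is its only ring homomorphism to `ℤ/ℓ`. -/
theorem ringHom_eq_toZMod (f : ℤ_[ℓ] →+* ZMod ℓ) (x : ℤ_[ℓ]) : f x = PadicInt.toZMod x := by
  have h := (PadicInt.zmodRepr_spec x).2
  rw [PadicInt.maximalIdeal_eq_span_p, Ideal.mem_span_singleton] at h
  obtain ⟨y, hy⟩ := h
  rw [sub_eq_iff_eq_add] at hy
  rw [hy]
  simp

/-- For a discriminant prime to `ℓ`, the Kronecker symbol counts the roots modulo `ℓ`. -/
theorem card_roots_eq_one_add_kroneckerChar (t m : ℤ_[ℓ]) (D : ℤ)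
    (hD : t ^ 2 - 4 * m = (D : ℤ_[ℓ])) (hℓD : ¬ (ℓ : ℤ) ∣ D) :
    ((Finset.univ.filter fun x : ZMod ℓ =>
      x ^ 2 + PadicInt.toZMod t * x + PadicInt.toZMod m = 0).card : ℤ) =
      1 + kroneckerChar ℓ D := by
  by_cases h2 : ℓ = 2
  · subst h2
    let f : ℤ_[2] →+* ZMod 8 := PadicInt.toZModPow 3
    have h := card_roots_two (f t) (f m) (D : ZMod 8) (by
      rw [← map_intCast f, ← hD]; simp [map_ofNat f 4]) (by
      rwa [map_intCast, Ne, ZMod.intCast_zmod_eq_zero_iff_dvd])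
    rw [kroneckerChar, if_pos rfl, ← h]
    simp only [← RingHom.comp_apply, ringHom_eq_toZMod]
  · rw [kroneckerChar, if_neg h2, add_comm, ← legendreSym.card_sqrts ℓ h2]
    have h2' : (2 : ZMod ℓ) ≠ 0 := by
      intro h
      have : ((2 : ℕ) : ZMod ℓ) = 0 := by exact_mod_cast h
      rw [ZMod.natCast_eq_zero_iff, Nat.prime_dvd_prime_iff_eq Fact.out Nat.prime_two] at this
      exact h2 this
    have hD' : PadicInt.toZMod t ^ 2 - 4 * PadicInt.toZMod m = (D : ZMod ℓ) := by
      simpa [map_ofNat (PadicInt.toZMod (p := ℓ)) 4] using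
        congrArg (PadicInt.toZMod (p := ℓ)) hD
    congr 1
    -- completing the square
    refine Finset.card_bij (fun x _ => 2 * x + PadicInt.toZMod t) ?_ ?_ ?_
    · intro x hx
      rw [Finset.mem_filter_univ] at hx
      simp only [Set.mem_toFinset, Set.mem_ofPred_eq]
      linear_combination 4 * hx + hD'
    · intro x _ y _ h
      exact mul_left_cancel₀ h2' (add_right_cancel h)
    · intro y hy
      simp only [Set.mem_toFinset, Set.mem_ofPred_eq] at hy
      refine ⟨(y - PadicInt.toZMod t) / 2, ?_, by field_simp; ring⟩
      rw [Finset.mem_filter_univ]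
      field_simp
      linear_combination hy - hD'

theorem isLocalRing_zmod_pow {n : ℕ} (hn : n ≠ 0) : IsLocalRing (ZMod (ℓ ^ n)) := by
  have : Nontrivial (ZMod (ℓ ^ n)) := ZMod.nontrivial_iff.2
    (Nat.one_lt_pow hn (Fact.out : ℓ.Prime).one_lt).ne'
  exact IsLocalRing.of_surjective' (PadicInt.toZModPow n) (ZMod.ringHom_surjective _)

theorem card_ker_mul {n : ℕ} (hn : n ≠ 0) :
    Nat.card {e : ZMod (ℓ ^ n) // (ℓ : ZMod (ℓ ^ n)) * e = 0} = ℓ := by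
  have : NeZero (ℓ ^ n) := ⟨pow_ne_zero _ (Fact.out : ℓ.Prime).ne_zero⟩
  have h := IsAddCyclic.card_nsmulAddMonoidHom_ker (ZMod (ℓ ^ n)) ℓ
  rw [Nat.card_zmod, Nat.gcd_eq_right (dvd_pow_self ℓ hn)] at h
  refine Eq.trans (Nat.card_congr (Equiv.subtypeEquivRight fun e => ?_)) h
  rw [AddMonoidHom.mem_ker, nsmulAddMonoidHom_apply, nsmul_eq_mul]

theorem isUnit_iff_castHom_ne_zero {n : ℕ} (hn : n ≠ 0) (x : ZMod (ℓ ^ n)) :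
    IsUnit x ↔ ZMod.castHom (dvd_pow_self ℓ hn) (ZMod ℓ) x ≠ 0 := by
  have := isLocalRing_zmod_pow (ℓ := ℓ) hn
  have := IsLocalHom.of_surjective (ZMod.castHom (dvd_pow_self ℓ hn) (ZMod ℓ))
    (ZMod.ringHom_surjective _)
  rw [← isUnit_iff_ne_zero, isUnit_map_iff]

theorem castHom_eq_zero_of_mul_eq_zero {n : ℕ} (hn : 2 ≤ n) {e : ZMod (ℓ ^ n)}
    (he : (ℓ : ZMod (ℓ ^ n)) * e = 0) :
    ZMod.castHom (dvd_pow_self ℓ (by omega : n ≠ 0)) (ZMod ℓ) e = 0 := by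
  by_contra h
  have := ((isUnit_iff_castHom_ne_zero (by omega) e).2 h).mul_left_eq_zero.1 he
  rw [ZMod.natCast_eq_zero_iff] at this
  have h1 := Nat.le_of_dvd (Fact.out : ℓ.Prime).pos this
  have h2 := Nat.pow_lt_pow_right (Fact.out : ℓ.Prime).one_lt (show 1 < n by omega)
  rw [pow_one] at h2
  omega

/-- The centralizer of `1 + ℓ C` in `GL₂(ℤ/ℓⁿ)`, for a companion matrix `C`, consists of the
invertible matrices that agree with some `x + r C` up to errors killed by `ℓ` in the two entries of
the second column. There are `ℓ` choices for each error. For `n ≥ 2` they vanish modulo `ℓ`, so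
invertibility only depends on the determinant of `x + r C` modulo `ℓ`. -/
theorem card_centralizer_mul_sq {n : ℕ} (hn : 2 ≤ n) (t m : ZMod (ℓ ^ n))
    (g : GL (Fin 2) (ZMod (ℓ ^ n)))
    (hg : g.val = 1 + (ℓ : ZMod (ℓ ^ n)) • companion t m) :
    Nat.card (Subgroup.centralizer {g}) * ℓ ^ 2 = ℓ ^ 2 * (ℓ ^ n) ^ 2 *
      Nat.card {w : ZMod ℓ × ZMod ℓ | w.1 ^ 2 +
        ZMod.castHom (dvd_pow_self ℓ (by omega : n ≠ 0)) (ZMod ℓ) t * w.1 * w.2 +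
        ZMod.castHom (dvd_pow_self ℓ (by omega : n ≠ 0)) (ZMod ℓ) m * w.2 ^ 2 ≠ 0} := by
  have hn0 : n ≠ 0 := by omega
  have : NeZero (ℓ ^ n) := ⟨pow_ne_zero _ (Fact.out : ℓ.Prime).ne_zero⟩
  set π := ZMod.castHom (dvd_pow_self ℓ hn0) (ZMod ℓ) with hπ
  set S := {w : ZMod ℓ × ZMod ℓ | w.1 ^ 2 + π t * w.1 * w.2 + π m * w.2 ^ 2 ≠ 0} with hS
  let f : ZMod (ℓ ^ n) × ZMod (ℓ ^ n) →+ ZMod ℓ × ZMod ℓ :=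
    (π : ZMod (ℓ ^ n) →+ ZMod ℓ).prodMap (π : ZMod (ℓ ^ n) →+ ZMod ℓ)
  have hf : Function.Surjective f :=
    Function.Surjective.prodMap (ZMod.ringHom_surjective π) (ZMod.ringHom_surjective π)
  have hcard := card_preimage_mul_card f hf S
  simp only [Nat.card_prod, Nat.card_zmod] at hcard
  let K := {e : ZMod (ℓ ^ n) // (ℓ : ZMod (ℓ ^ n)) * e = 0}
  have hdet : ∀ x r e₁ e₂ : ZMod (ℓ ^ n), (ℓ : ZMod (ℓ ^ n)) * e₁ = 0 →
      (ℓ : ZMod (ℓ ^ n)) * e₂ = 0 →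
      (IsUnit (!![x, -m * r + e₁; r, x + r * t + e₂].det) ↔ (x, r) ∈ f ⁻¹' S) := by
    intro x r e₁ e₂ h₁ h₂
    have h₁' := castHom_eq_zero_of_mul_eq_zero hn h₁
    have h₂' := castHom_eq_zero_of_mul_eq_zero hn h₂
    rw [isUnit_iff_castHom_ne_zero hn0, Matrix.det_fin_two_of]
    simp only [map_sub, map_mul, map_add, map_neg, h₁', h₂', Set.mem_preimage, hS,
      Set.mem_ofPred_eq, f, AddMonoidHom.coe_prodMap, Prod.map]
    refine not_congr (Eq.congr ?_ rfl)
    simp only [AddMonoidHom.coe_coe]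
    ring
  have hcomm : ∀ A : Matrix (Fin 2) (Fin 2) (ZMod (ℓ ^ n)),
      A * g.val = g.val * A ↔ (ℓ : ZMod (ℓ ^ n)) * (A 0 1 + m * A 1 0) = 0 ∧
        (ℓ : ZMod (ℓ ^ n)) * (A 1 1 - A 0 0 - A 1 0 * t) = 0 := by
    intro A
    rw [hg, mul_add, add_mul, mul_one, one_mul, add_right_inj, ← Matrix.ext_iff]
    simp only [companion, Fin.forall_fin_two, Matrix.mul_apply, Fin.sum_univ_two,
      Matrix.smul_apply, smul_eq_mul, Matrix.of_apply, Matrix.cons_val', Matrix.cons_val_zero,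
      Matrix.cons_val_one, Matrix.cons_val_fin_one]
    constructor
    · rintro ⟨⟨h₁, h₂⟩, h₃, h₄⟩
      exact ⟨by linear_combination h₁, by linear_combination h₃⟩
    · rintro ⟨h₁, h₂⟩
      refine ⟨⟨?_, ?_⟩, ?_, ?_⟩
      · linear_combination h₁
      · linear_combination m * h₂ + t * h₁
      · linear_combination h₂
      · linear_combination -h₁
  have e : Subgroup.centralizer {g} ≃ (f ⁻¹' S) × (K × K) :=
    { toFun := fun A =>
        have hA := (hcomm A.1.val).1
          (congrArg Units.val (Subgroup.mem_centralizer_singleton_iff.1 A.2))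
        ⟨⟨(A.1.val 0 0, A.1.val 1 0), (hdet _ _ _ _ hA.1 hA.2).1 (by
          convert (Matrix.isUnit_iff_isUnit_det _).1 A.1.isUnit using 1
          rw [Matrix.det_fin_two_of, Matrix.det_fin_two]
          ring)⟩, ⟨_, hA.1⟩, ⟨_, hA.2⟩⟩
      invFun := fun w => ⟨Matrix.GeneralLinearGroup.mk''
          !![w.1.1.1, -m * w.1.1.2 + w.2.1.1; w.1.1.2, w.1.1.1 + w.1.1.2 * t + w.2.2.1]
          ((hdet _ _ _ _ w.2.1.2 w.2.2.2).2 w.1.2), by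
        rw [Subgroup.mem_centralizer_singleton_iff]
        refine Units.ext ((hcomm _).2 ⟨?_, ?_⟩)
        · refine Eq.trans ?_ w.2.1.2
          simp
        · refine Eq.trans ?_ w.2.2.2
          simp
          ring⟩
      left_inv := by
        intro A
        refine Subtype.ext (Units.ext ?_)
        ext i j
        fin_cases i <;> fin_cases j <;> simp
      right_inv := by
        rintro ⟨⟨⟨x, r⟩, h⟩, ⟨e₁, h₁⟩, ⟨e₂, h₂⟩⟩
        refine Prod.ext (Subtype.ext ?_) (Prod.ext (Subtype.ext ?_) (Subtype.ext ?_)) <;> simp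
        ring }
  rw [Nat.card_congr e, Nat.card_prod, Nat.card_prod, card_ker_mul hn0]
  linear_combination ℓ ^ 2 * hcard

end Count

/-! ### The conjugacy class and the ratio -/

section Class
variable {ℓ : ℕ} [Fact ℓ.Prime]

theorem card_conjugatesOf_mul_card_centralizer {G : Type*} [Group G] (g : G) :
    (conjugatesOf g).ncard * Nat.card (Subgroup.centralizer {g}) = Nat.card G := by
  have h : conjugatesOf g = MulAction.orbit (ConjAct G) g := by
    ext x
    rw [ConjAct.mem_orbit_conjAct, isConj_comm]
    rfl
  have e := Nat.card_congr (MulAction.orbitProdStabilizerEquivGroup (ConjAct G) g)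
  rw [Nat.card_prod, ← Subgroup.nat_card_centralizer_nat_card_stabilizer, ← h] at e
  exact e

theorem reduction_surjective {n : ℕ} (hn : n ≠ 0) : Function.Surjective (reduction ℓ n) := by
  have : Nontrivial (ZMod (ℓ ^ n)) := ZMod.nontrivial_iff.2
    (Nat.one_lt_pow hn (Fact.out : ℓ.Prime).one_lt).ne'
  have hs : Function.Surjective (PadicInt.toZModPow (p := ℓ) n) := ZMod.ringHom_surjective _
  have := IsLocalHom.of_surjective _ hs
  intro B
  obtain ⟨A, hA⟩ : ∃ A : Matrix (Fin 2) (Fin 2) ℤ_[ℓ], A.map (PadicInt.toZModPow n) = B.val := by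
    choose s hs' using hs
    exact ⟨B.val.map s, by ext i j; simp [hs']⟩
  have hdet : IsUnit A.det := by
    rw [← isUnit_map_iff (PadicInt.toZModPow (p := ℓ) n), RingHom.map_det,
      RingHom.mapMatrix_apply, hA]
    exact (Matrix.isUnit_iff_isUnit_det _).1 B.isUnit
  exact ⟨Matrix.GeneralLinearGroup.mk'' A hdet, Units.ext hA⟩

theorem mem_principalSubgroup_iff (γ : GL (Fin 2) ℤ_[ℓ]) :
    γ ∈ principalSubgroup ℓ ↔
      ∃ M : Matrix (Fin 2) (Fin 2) ℤ_[ℓ], γ.val = 1 + (ℓ : ℤ_[ℓ]) • M := by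
  have hker : ∀ x : ℤ_[ℓ], PadicInt.toZMod x = 0 ↔ (ℓ : ℤ_[ℓ]) ∣ x := by
    intro x
    rw [← RingHom.mem_ker, PadicInt.ker_toZMod, PadicInt.maximalIdeal_eq_span_p,
      Ideal.mem_span_singleton]
  have hmap : γ ∈ principalSubgroup ℓ ↔ ∀ i j, PadicInt.toZMod ((γ.val - 1) i j) = 0 := by
    rw [principalSubgroup, MonoidHom.mem_ker, ← Units.val_inj, ← Matrix.ext_iff]
    refine forall₂_congr fun i j => ?_
    rw [Matrix.sub_apply, map_sub, sub_eq_zero]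
    refine Eq.congr rfl ?_
    rw [Units.val_one, Matrix.one_apply, Matrix.one_apply]
    split_ifs <;> simp
  rw [hmap]
  constructor
  · intro h
    choose M hM using fun i j => (hker _).1 (h i j)
    refine ⟨Matrix.of M, ?_⟩
    rw [← sub_eq_iff_eq_add']
    ext i j
    simpa using hM i j
  · rintro ⟨M, hM⟩ i j
    rw [hker, hM]
    exact ⟨M i j, by simp⟩

theorem ker_reduction_le_principalSubgroup {n : ℕ} (hn : n ≠ 0) :
    (reduction ℓ n).ker ≤ principalSubgroup ℓ := by
  intro γ hγ
  have h : (Matrix.GeneralLinearGroup.map (n := Fin 2)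
      (ZMod.castHom (dvd_pow_self ℓ hn) (ZMod ℓ))) (reduction ℓ n γ) = 1 := by
    rw [MonoidHom.mem_ker.1 hγ, map_one]
  rw [principalSubgroup, MonoidHom.mem_ker, ← h]
  refine Units.ext (Matrix.ext fun i j => ?_)
  exact (ringHom_eq_toZMod ((ZMod.castHom (dvd_pow_self ℓ hn) (ZMod ℓ)).comp
    (PadicInt.toZModPow n)) _).symm

theorem valuation_eq_zero_of_isUnit {x : ℤ_[ℓ]} (hx : IsUnit x) : x.valuation = 0 := by
  obtain ⟨y, hy⟩ := hx.exists_right_inv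
  have hy0 : y ≠ 0 := by rintro rfl; simp at hy
  have h := PadicInt.valuation_mul hx.ne_zero hy0
  rw [hy, PadicInt.valuation_one] at h
  omega

/-- Write `γ₀ = 1 + ℓ N` with `N` of unit discriminant. An element `1 + ℓ M` is conjugate to `γ₀`
over `ℚ_ℓ` only if `M` and `N` have the same characteristic polynomial, and then both are integrally
conjugate to the same companion matrix. So, whatever the bound `d`, the truncated class is a single
conjugacy class of `GL₂(ℤ/ℓⁿ)`. -/
theorem conjClassTrunc_inter_eq_conjugatesOf {N : Matrix (Fin 2) (Fin 2) ℤ_[ℓ]}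
    (hN : IsUnit (N.trace ^ 2 - 4 * N.det)) (c : GL (Fin 2) ℤ_[ℓ])
    (hc : c.val = 1 + (ℓ : ℤ_[ℓ]) • companion N.trace N.det) (d : ℕ) {n : ℕ} (hn : n ≠ 0) :
    conjClassTrunc (1 + (ℓ : ℤ_[ℓ]) • N) d n ∩
        reduction ℓ n '' (principalSubgroup ℓ : Set (GL (Fin 2) ℤ_[ℓ])) =
      conjugatesOf (reduction ℓ n c) := by
  have hℓ : (ℓ : ℤ_[ℓ]) ≠ 0 := Nat.cast_ne_zero.2 (Fact.out : ℓ.Prime).ne_zero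
  have hconj : ∀ {M P C : Matrix (Fin 2) (Fin 2) ℤ_[ℓ]}, M * P = P * C →
      (1 + (ℓ : ℤ_[ℓ]) • M) * P = P * (1 + (ℓ : ℤ_[ℓ]) • C) := by
    intro M P C h
    rw [add_mul, mul_add, one_mul, mul_one, smul_mul_assoc, mul_smul_comm, h]
  have hcΓ : c ∈ principalSubgroup ℓ := (mem_principalSubgroup_iff c).2 ⟨_, hc⟩
  ext x
  constructor
  · rintro ⟨⟨γ, ⟨A, ⟨hA, -⟩, hAγ⟩, rfl⟩, δ, hδ, hδγ⟩
    -- `γ` has the same reduction as some `δ ∈ Γ`, and `Γ` contains the kernel of the reduction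
    have hγ : γ ∈ principalSubgroup ℓ := by
      have h : γ * δ⁻¹ ∈ principalSubgroup ℓ := ker_reduction_le_principalSubgroup hn (by
        rw [MonoidHom.mem_ker, map_mul, map_inv, hδγ, mul_inv_cancel])
      simpa using mul_mem h hδ
    obtain ⟨M, hM⟩ := (mem_principalSubgroup_iff γ).1 hγ
    obtain ⟨htr, hdet⟩ := trace_eq_and_det_eq_of_mul_eq_mul hA hAγ
    rw [hM, trace_one_add_smul, trace_one_add_smul, add_right_inj] at htr
    have htr' := mul_left_cancel₀ hℓ htr
    rw [hM, det_one_add_smul, det_one_add_smul, htr', add_right_inj] at hdet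
    have hdet' := mul_left_cancel₀ (pow_ne_zero 2 hℓ) hdet
    obtain ⟨P, hP⟩ := exists_mul_eq_mul_companion M (by rwa [htr', hdet'])
    rw [htr', hdet'] at hP
    have h : γ * P = P * c := Units.ext (by
      rw [Units.val_mul, Units.val_mul, hM, hc, hconj hP])
    exact isConj_iff.2 ⟨reduction ℓ n P, by rw [← map_mul, ← h, map_mul, mul_inv_cancel_right]⟩
  · intro hx
    obtain ⟨B', rfl⟩ := isConj_iff.1 (show IsConj (reduction ℓ n c) x from hx)
    obtain ⟨B, rfl⟩ := reduction_surjective hn B'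
    rw [← map_inv, ← map_mul, ← map_mul]
    have hmem : B * c * B⁻¹ ∈ principalSubgroup ℓ :=
      (MonoidHom.normal_ker _).conj_mem c hcΓ B
    refine ⟨⟨_, ?_, rfl⟩, _, hmem, rfl⟩
    obtain ⟨P, hP⟩ := exists_mul_eq_mul_companion N hN
    have hunit : IsUnit (P * B⁻¹).val.det := (Matrix.isUnit_iff_isUnit_det _).1 (Units.isUnit _)
    -- the conjugating matrix is invertible over `ℤ_ℓ`, so the bound `d` is satisfied trivially
    refine ⟨(P * B⁻¹).val, ⟨hunit.ne_zero, ?_⟩, ?_⟩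
    · rw [valuation_eq_zero_of_isUnit hunit]
      exact Nat.zero_le d
    · rw [← Units.val_mul, show P * B⁻¹ * (B * c * B⁻¹) = P * c * B⁻¹ by group,
        Units.val_mul, Units.val_mul, Units.val_mul, hc, ← hconj hP, mul_assoc]

/-- From `n = 2` on, the ratio is constant in `n` and `d`: it is `#𝔸_G(ℤ/ℓⁿ)` divided by the order
of the centralizer of `γ₀` in `GL₂(ℤ/ℓⁿ)`. -/
theorem levelRatio_eq {N : Matrix (Fin 2) (Fin 2) ℤ_[ℓ]}
    (hdet : IsUnit (1 + (ℓ : ℤ_[ℓ]) • N).det) {D : ℤ}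
    (hD : N.trace ^ 2 - 4 * N.det = (D : ℤ_[ℓ])) (hℓD : ¬ (ℓ : ℤ) ∣ D) (d : ℕ) {n : ℕ}
    (hn : 2 ≤ n) :
    levelRatio (principalSubgroup ℓ) (1 + (ℓ : ℤ_[ℓ]) • N) d n =
      1 / (ℓ : ℝ) ^ 2 * (1 / (1 - (kroneckerChar ℓ D : ℝ) / ℓ)) := by
  have hprime : ℓ.Prime := Fact.out
  have hn0 : n ≠ 0 := by omega
  have : NeZero (ℓ ^ n) := ⟨pow_ne_zero _ hprime.ne_zero⟩
  have hunit : IsUnit (N.trace ^ 2 - 4 * N.det) := by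
    rw [hD]
    by_contra h
    rw [PadicInt.not_isUnit_iff, PadicInt.norm_int_lt_one_iff_dvd] at h
    exact hℓD h
  have hc : IsUnit (1 + (ℓ : ℤ_[ℓ]) • companion N.trace N.det).det := by
    rwa [det_one_add_smul, trace_companion, det_companion, ← det_one_add_smul]
  set c := Matrix.GeneralLinearGroup.mk'' _ hc with hcdef
  have hred : (reduction ℓ n c).val = 1 + (ℓ : ZMod (ℓ ^ n)) •
      companion (PadicInt.toZModPow n N.trace) (PadicInt.toZModPow n N.det) := by
    change (1 + (ℓ : ℤ_[ℓ]) • companion N.trace N.det).map (PadicInt.toZModPow n) = _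
    ext i j
    fin_cases i <;> fin_cases j <;> simp [companion]
  have horbit := card_conjugatesOf_mul_card_centralizer (reduction ℓ n c)
  have hcent := card_centralizer_mul_sq hn _ _ _ hred
  have hform := card_normForm_ne_zero (PadicInt.toZMod N.trace : ZMod ℓ) (PadicInt.toZMod N.det)
  rw [card_roots_eq_one_add_kroneckerChar _ _ D hD hℓD, ZMod.card] at hform
  simp only [← RingHom.comp_apply, ringHom_eq_toZMod] at hcent
  set Q := Nat.card {w : ZMod ℓ × ZMod ℓ | w.1 ^ 2 + PadicInt.toZMod N.trace * w.1 * w.2 +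
    PadicInt.toZMod N.det * w.2 ^ 2 ≠ 0}
  rw [levelRatio, conjClassTrunc_inter_eq_conjugatesOf hunit c rfl d hn0, ← horbit, Nat.card_prod,
    Nat.card_zmod, Nat.card_eq_fintype_card (α := (ZMod (ℓ ^ n))ˣ), ZMod.card_units_eq_totient,
    Nat.totient_prime_pow hprime (Nat.pos_of_ne_zero hn0)]
  have horb0 : ((conjugatesOf (reduction ℓ n c)).ncard : ℝ) ≠ 0 := by
    intro h
    rw [Nat.cast_eq_zero] at h
    rw [h, zero_mul] at horbit
    exact Nat.card_pos.ne horbit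
  have hcent0 : (Nat.card (Subgroup.centralizer {reduction ℓ n c}) : ℝ) ≠ 0 :=
    Nat.cast_ne_zero.2 Nat.card_pos.ne'
  have hℓ0 : (ℓ : ℝ) ≠ 0 := Nat.cast_ne_zero.2 hprime.ne_zero
  have hℓ1 : (ℓ : ℝ) - 1 ≠ 0 := sub_ne_zero.2 (by exact_mod_cast hprime.one_lt.ne')
  have hform' : (Q : ℝ) = (ℓ - 1) * (ℓ - kroneckerChar ℓ D) := by
    have : (Q : ℤ) = (ℓ - 1) * (ℓ - kroneckerChar ℓ D) := by rw [hform]; ring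
    exact_mod_cast this
  have hcent' : (Nat.card (Subgroup.centralizer {reduction ℓ n c}) : ℝ) =
      (ℓ ^ n) ^ 2 * ((ℓ - 1) * (ℓ - kroneckerChar ℓ D)) := by
    rw [← hform']
    apply mul_right_cancel₀ (pow_ne_zero 2 hℓ0)
    have : (Nat.card (Subgroup.centralizer {reduction ℓ n c}) : ℝ) * ℓ ^ 2 =
      ℓ ^ 2 * (ℓ ^ n) ^ 2 * Q := by exact_mod_cast hcent
    rw [this]
    ring
  have hχ : (ℓ : ℝ) - kroneckerChar ℓ D ≠ 0 := by
    intro h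
    rw [h] at hcent'
    simp [hcent'] at hcent0
  have hpow : (ℓ : ℝ) ^ n = ℓ ^ (n - 1) * ℓ := by
    rw [← pow_succ, Nat.sub_add_cancel (by omega)]
  push_cast [Nat.cast_sub hprime.one_le]
  rw [hcent', hpow]
  have hpow0 : (ℓ : ℝ) ^ (n - 1) ≠ 0 := pow_ne_zero _ hℓ0
  generalize (ℓ : ℝ) ^ (n - 1) = y at *
  field_simp

end Class

end EllipticLevel

end

open EllipticLevel Polynomial in
theorem mainTheorem8 (p : ℕ) [Fact p.Prime] {F : Type*} [Field F] [Fintype F] [CharP F p]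
    (E : WeierstrassCurve F) [E.IsElliptic]
    (ℓ₀ : ℕ) [Fact ℓ₀.Prime] (hℓ₀ : ℓ₀ ≠ p)
    (b : Module.Basis (Fin 2) ℤ_[ℓ₀] (H1 E ℓ₀))
    (a : ℤ)
    (hf : (frobeniusMatrix b).charpoly =
      (X ^ 2 - C a * X + C (Fintype.card F : ℤ) : ℤ[X]).map (Int.castRingHom ℤ_[ℓ₀]))
    (hpa : ¬ (p : ℤ) ∣ a)
    (hdvd : (ℓ₀ : ℤ) ^ 2 ∣ a ^ 2 - 4 * (Fintype.card F : ℤ))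
    (hexact : ¬ (ℓ₀ : ℤ) ^ 3 ∣ a ^ 2 - 4 * (Fintype.card F : ℤ))
    (α : FullLevelStructure E ℓ₀) :
    IsLocalFactor (principalSubgroup ℓ₀) (frobeniusMatrix b)
      (1 / (ℓ₀ : ℝ) ^ 2 *
        (1 / (1 - (kroneckerChar ℓ₀
          ((a ^ 2 - 4 * (Fintype.card F : ℤ)) / (ℓ₀ : ℤ) ^ 2) : ℝ) / (ℓ₀ : ℝ)))) := by
  have hprime : ℓ₀.Prime := Fact.out
  have htrace : (frobeniusMatrix b).trace = a := by
    rw [Matrix.trace_eq_neg_charpoly_coeff, hf]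
    simp
  have hdet : (frobeniusMatrix b).det = Fintype.card F := by
    rw [Matrix.det_eq_sign_charpoly_coeff, hf]
    simp
  have hdet_unit : IsUnit (frobeniusMatrix b).det := by
    obtain ⟨k, hp, hk⟩ := FiniteField.card F p
    rw [hdet, hk]
    by_contra h
    rw [PadicInt.not_isUnit_iff, ← Int.cast_natCast, PadicInt.norm_int_lt_one_iff_dvd] at h
    exact hℓ₀ ((Nat.prime_dvd_prime_iff_eq hprime hp).1
      (hprime.dvd_of_dvd_pow (Int.natCast_dvd_natCast.1 h)))
  obtain ⟨N, hN⟩ := exists_frobeniusMatrix_eq α b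
  obtain ⟨D, hD⟩ := hdvd
  have hℓ0 : (ℓ₀ : ℤ) ^ 2 ≠ 0 := pow_ne_zero 2 (Nat.cast_ne_zero.2 hprime.ne_zero)
  rw [hD, Int.mul_ediv_cancel_left _ hℓ0]
  have hℓD : ¬ (ℓ₀ : ℤ) ∣ D := by
    rintro ⟨k, rfl⟩
    exact hexact ⟨k, by rw [hD]; ring⟩
  rw [hN] at htrace hdet hdet_unit ⊢
  rw [trace_one_add_smul] at htrace
  rw [det_one_add_smul] at hdet
  have hdisc : N.trace ^ 2 - 4 * N.det = (D : ℤ_[ℓ₀]) := by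
    have hD' : (a : ℤ_[ℓ₀]) ^ 2 - 4 * (Fintype.card F : ℤ_[ℓ₀]) = (ℓ₀ : ℤ_[ℓ₀]) ^ 2 * D := by
      exact_mod_cast congrArg (Int.cast : ℤ → ℤ_[ℓ₀]) hD
    apply mul_left_cancel₀ (pow_ne_zero 2 (Nat.cast_ne_zero.2 hprime.ne_zero : (ℓ₀ : ℤ_[ℓ₀]) ≠ 0))
    rw [← hD', ← htrace, ← hdet]
    ring
  refine ⟨fun _ => _, fun d => ?_, tendsto_const_nhds⟩
  refine tendsto_const_nhds.congr' ?_
  filter_upwards [eventually_ge_atTop 2] with n hn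
  exact (levelRatio_eq hdet_unit hdisc hℓD d hn).symm
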